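/- **Theorem 1 (C*-norm on bounded elements).** Let $T$ be a unital associative complex $*$-algebra, $T_h=\{x\in T: x^*=x\}$, let $K=\{\sum_{i=1}^n x_i^*x_i : n\in\mathbb N,\ x_i\in T\}$, and write $x\le y$ if $y-x\in K$. Assume that $T$ is an $RO^*$-algebra, i.e. - (Rickart) for every $x\in T$ there is a projection $e=e^*=e^2\in T$ with $\{y\in T: xy=0\}=eT$; - (positive square roots) for every $x\in K$ there is $y\in K\cap\{x\}''$ with $y^2=x$, where $\{x\}''$ is the bicommutant of $x$ in $T$; - (Fisher–Riesz) if $x_n\in T_h$ and $0\le x_n\le\varepsilon_n 1$ for all $n$, with $\varepsilon_n\ge 0$ and $\sum_n\varepsilon_n<\infty$, then the sequence of partial sums $\sum_{k\le n}x_k$ has a supremum in $T_h$. An element $a+ib$ ($a,b\in T_h$) is bounded if $-\lambda 1\le a,b\le\lambda 1$ for some real $\lambda\ge 0$. Let $M$ be the $*$-subalgebra of all bounded elements of $T$, and $M_h=M\cap T_h$. 1. The formula $\|x\|=\inf\{\lambda\ge 0: -\lambda 1\le x\le\lambda 1\}$ defines a norm on $M_h$, with respect to which $M_h$ is a real Banach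 space and the cone $K\cap M$ is closed. 2. There is a norm $q$ on $M$ that extends $\|\cdot\|$ and makes $M$, with its given $*$-algebra structure, a C*-algebra (complete, with $q(xy)\le q(x)q(y)$ and $q(x^*x)=q(x)^2$). It is realised as follows. A state of $M$ is a linear functional $\varphi:M\to\mathbb C$ with $\varphi(x^*x)\ge 0$ for all $x\in M$ and $\varphi(1)=1$; $H_\varphi$ denotes the Hausdorff completion of $M$ for the semi-inner product $\langle x,y\rangle=\varphi(x^*y)$. For every state $\varphi$, left multiplication by elements of $M$ extends to a $*$-representation $\pi_\varphi$ of $M$ by bounded operators on $H_\varphi$ (the GNS representation). The direct sum $\pi=\bigoplus_\varphi\pi_\varphi$ over all states of $M$ is a well-defined faithful $*$-representation of $M$ by bounded operators on the Hilbert space $\bigoplus_\varphi H_\varphi$, and $q(x)=\|\pi(x)\|$ for all $x\in M$. -/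

import Mathlib

open scoped ComplexOrder InnerProductSpace

noncomputable section

/-! ### Rickart ordered *-algebras -/

/-- A Rickart *-ring: the right annihilator of each element is the principal right ideal generated
by a projection. -/
class RickartStarRing (T : Type*) [Ring T] [StarRing T] : Prop where
  exists_projection : ∀ x : T, ∃ e : T, IsStarProjection e ∧
    {y : T | x * y = 0} = {y : T | ∃ z : T, y = e * z}

/-- The cone `K` of all finite sums of elements of the form `star s * s`. -/
def sumsOfSquares (T : Type*) [Ring T] [StarRing T] : AddSubmonoid T :=
  AddSubmonoid.closure (Set.range fun s : T => star s * s)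

/-- The order relation induced by the cone `K`: `x ≤ y` iff `y - x ∈ K`. -/
def KLE {T : Type*} [Ring T] [StarRing T] (x y : T) : Prop :=
  y - x ∈ sumsOfSquares T

/-- The scalar multiple `r 1` of the unit, for real `r`. -/
def realOne (T : Type*) [Ring T] [Algebra ℂ T] (r : ℝ) : T := (r : ℂ) • (1 : T)

/-- An RO*-algebra: a complex Rickart *-algebra with the positive square root axiom and the
Fisher-Riesz axiom. -/
class ROStarAlgebra (T : Type*) [Ring T] [StarRing T] [Algebra ℂ T] [StarModule ℂ T] : Prop
    extends RickartStarRing T where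
  /-- Every `x ∈ K` has a square root `y` in `K` lying in the bicommutant of `x`. -/
  exists_sqrt : ∀ x ∈ sumsOfSquares T, ∃ y ∈ sumsOfSquares T,
    y ∈ Set.centralizer (Set.centralizer ({x} : Set T)) ∧ y * y = x
  /-- If `0 ≤ xₙ ≤ εₙ 1` with `∑ εₙ < ∞`, the partial sums of `∑ xₙ` have a supremum among the
  self-adjoint elements. -/
  exists_sup : ∀ (x : ℕ → T) (ε : ℕ → ℝ), (∀ n, IsSelfAdjoint (x n)) → (∀ n, 0 ≤ ε n) →
    (∀ n, KLE 0 (x n) ∧ KLE (x n) (realOne T (ε n))) → Summable ε →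
    ∃ s : T, IsSelfAdjoint s ∧ (∀ n, KLE (∑ k ∈ Finset.range n, x k) s) ∧
      ∀ t : T, IsSelfAdjoint t → (∀ n, KLE (∑ k ∈ Finset.range n, x k) t) → KLE s t

/-! ### Bounded elements -/

/-- `a + i b` (`a`, `b` self-adjoint) is bounded if `-r 1 ≤ a, b ≤ r 1` for some real `r ≥ 0`. -/
def IsBoundedElement {T : Type*} [Ring T] [StarRing T] [Algebra ℂ T] (x : T) : Prop :=
  ∃ a b : T, IsSelfAdjoint a ∧ IsSelfAdjoint b ∧ x = a + Complex.I • b ∧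
    ∃ r : ℝ, 0 ≤ r ∧ KLE (-realOne T r) a ∧ KLE a (realOne T r) ∧
      KLE (-realOne T r) b ∧ KLE b (realOne T r)

/-- The order-unit norm `inf {r ≥ 0 : -r 1 ≤ x ≤ r 1}` (used for bounded self-adjoint `x`). -/
def orderUnitNorm {T : Type*} [Ring T] [StarRing T] [Algebra ℂ T] (x : T) : ℝ :=
  sInf {r : ℝ | 0 ≤ r ∧ KLE (-realOne T r) x ∧ KLE x (realOne T r)}

section BoundedElements

set_option linter.unusedSectionVars false

variable {T : Type*} [Ring T] [StarRing T] [Algebra ℂ T]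

theorem star_mul_self_mem_K (s : T) : star s * s ∈ sumsOfSquares T :=
  AddSubmonoid.subset_closure ⟨s, rfl⟩

theorem sq_mem_K {s : T} (hs : IsSelfAdjoint s) : s * s ∈ sumsOfSquares T := by
  simpa [hs.star_eq] using star_mul_self_mem_K s

theorem isSelfAdjoint_of_mem_K {x : T} (hx : x ∈ sumsOfSquares T) : IsSelfAdjoint x := by
  induction hx using AddSubmonoid.closure_induction with
  | mem x h => obtain ⟨s, rfl⟩ := h; exact IsSelfAdjoint.star_mul_self s
  | zero => exact IsSelfAdjoint.zero T
  | add x y _ _ hx hy => exact hx.add hy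

/-- Self-adjoint, with `-r 1 ≤ a ≤ r 1`. -/
def SABound (r : ℝ) (a : T) : Prop :=
  0 ≤ r ∧ IsSelfAdjoint a ∧ realOne T r + a ∈ sumsOfSquares T ∧ realOne T r - a ∈ sumsOfSquares T

theorem realOne_add (r s : ℝ) : realOne T (r + s) = realOne T r + realOne T s := by
  simp [realOne, add_smul]

variable [StarModule ℂ T]

theorem smul_mem_K {x : T} (hx : x ∈ sumsOfSquares T) {r : ℝ} (hr : 0 ≤ r) :
    (r : ℂ) • x ∈ sumsOfSquares T := by
  induction hx using AddSubmonoid.closure_induction with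
  | mem x h =>
    obtain ⟨s, rfl⟩ := h
    have := star_mul_self_mem_K (((Real.sqrt r : ℝ) : ℂ) • s)
    simpa [star_smul, smul_smul, ← Complex.ofReal_mul, Real.mul_self_sqrt hr] using this
  | zero => simp
  | add x y _ _ hx hy => rw [smul_add]; exact add_mem hx hy

theorem realOne_mem_K {r : ℝ} (hr : 0 ≤ r) : realOne T r ∈ sumsOfSquares T :=
  smul_mem_K (by simpa using star_mul_self_mem_K (1 : T)) hr

theorem SABound.mono {r s : ℝ} {a : T} (h : SABound r a) (hrs : r ≤ s) : SABound s a := by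
  obtain ⟨h0, ha, h1, h2⟩ := h
  have h3 : realOne T (s - r) ∈ sumsOfSquares T := realOne_mem_K (by linarith)
  have h4 : realOne T s = realOne T r + realOne T (s - r) := by rw [← realOne_add]; simp
  refine ⟨h0.trans hrs, ha, ?_, ?_⟩ <;> rw [h4]
  · convert add_mem h1 h3 using 1; abel
  · convert add_mem h2 h3 using 1; abel

theorem SABound.add {r s : ℝ} {a b : T} (h : SABound r a) (k : SABound s b) :
    SABound (r + s) (a + b) := by
  refine ⟨add_nonneg h.1 k.1, h.2.1.add k.2.1, ?_, ?_⟩ <;> rw [realOne_add]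
  · convert add_mem h.2.2.1 k.2.2.1 using 1; abel
  · convert add_mem h.2.2.2 k.2.2.2 using 1; abel

theorem SABound.neg {r : ℝ} {a : T} (h : SABound r a) : SABound r (-a) :=
  ⟨h.1, h.2.1.neg, by simpa [sub_eq_add_neg] using h.2.2.2, by simpa using h.2.2.1⟩

theorem SABound.half {r : ℝ} {a : T} (h : SABound r a) : SABound (r / 2) ((1 / 2 : ℂ) • a) := by
  have e : realOne T (r / 2) = (((1 / 2 : ℝ)) : ℂ) • realOne T r := by
    simp only [realOne, smul_smul, ← Complex.ofReal_mul]; congr 2; ring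
  have e' : (1 / 2 : ℂ) • a = (((1 / 2 : ℝ)) : ℂ) • a := by simp
  have half : (0 : ℝ) ≤ 1 / 2 := by norm_num
  refine ⟨by linarith [h.1], ?_, ?_, ?_⟩
  · rw [e', IsSelfAdjoint, star_smul, h.2.1.star_eq]; simp
  · rw [e, e', ← smul_add]; exact smul_mem_K h.2.2.1 half
  · rw [e, e', ← smul_sub]; exact smul_mem_K h.2.2.2 half

theorem isBoundedElement_iff {x : T} : IsBoundedElement x ↔
    ∃ (r s : ℝ) (a b : T), SABound r a ∧ SABound s b ∧ x = a + Complex.I • b := by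
  constructor
  · rintro ⟨a, b, ha, hb, hx, r, hr, h1, h2, h3, h4⟩
    refine ⟨r, r, a, b, ⟨hr, ha, ?_, h2⟩, ⟨hr, hb, ?_, h4⟩, hx⟩
    · simpa [KLE, add_comm] using h1
    · simpa [KLE, add_comm] using h3
  · rintro ⟨r, s, a, b, ha, hb, hx⟩
    have ha' := ha.mono (le_max_left r s)
    have hb' := hb.mono (le_max_right r s)
    refine ⟨a, b, ha.2.1, hb.2.1, hx, max r s, ha'.1, ?_, ha'.2.2.2, ?_, hb'.2.2.2⟩
    · simpa [KLE, add_comm] using ha'.2.2.1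
    · simpa [KLE, add_comm] using hb'.2.2.1

theorem SABound.isBoundedElement {r : ℝ} {a : T} (h : SABound r a) : IsBoundedElement a :=
  isBoundedElement_iff.2 ⟨r, 0, a, 0, h,
    ⟨le_rfl, IsSelfAdjoint.zero T, by simp [realOne], by simp [realOne]⟩, by simp⟩

theorem IsBoundedElement.add {x y : T} (hx : IsBoundedElement x) (hy : IsBoundedElement y) :
    IsBoundedElement (x + y) := by
  rw [isBoundedElement_iff] at *
  obtain ⟨r, s, a, b, ha, hb, rfl⟩ := hx
  obtain ⟨r', s', a', b', ha', hb', rfl⟩ := hy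
  exact ⟨_, _, _, _, ha.add ha', hb.add hb', by rw [smul_add]; abel⟩

theorem IsBoundedElement.I_smul {x : T} (hx : IsBoundedElement x) :
    IsBoundedElement (Complex.I • x) := by
  rw [isBoundedElement_iff] at *
  obtain ⟨r, s, a, b, ha, hb, rfl⟩ := hx
  refine ⟨_, _, _, _, hb.neg, ha, ?_⟩
  rw [smul_add, smul_smul, Complex.I_mul_I]; simp [add_comm]

theorem IsBoundedElement.neg {x : T} (hx : IsBoundedElement x) : IsBoundedElement (-x) := by
  have := hx.I_smul.I_smul
  rwa [smul_smul, Complex.I_mul_I, neg_one_smul] at this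

theorem IsBoundedElement.star {x : T} (hx : IsBoundedElement x) :
    IsBoundedElement (star x) := by
  rw [isBoundedElement_iff] at *
  obtain ⟨r, s, a, b, ha, hb, rfl⟩ := hx
  exact ⟨_, _, _, _, ha, hb.neg, by simp [star_smul, ha.2.1.star_eq, hb.2.1.star_eq]⟩

theorem isBoundedElement_smul_one (c : ℂ) : IsBoundedElement (c • (1 : T)) := by
  have key : ∀ r : ℝ, 0 ≤ r → IsBoundedElement (realOne T r) := fun r hr =>
    SABound.isBoundedElement (r := r) ⟨hr, isSelfAdjoint_of_mem_K (realOne_mem_K hr),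
      add_mem (realOne_mem_K hr) (realOne_mem_K hr), by simp⟩
  have key' : ∀ r : ℝ, IsBoundedElement (realOne T r) := fun r => by
    rcases le_total 0 r with h | h
    · exact key r h
    · have := (key (-r) (by linarith)).neg
      simpa [realOne] using this
  have h := (key' c.re).add (key' c.im).I_smul
  have e : c • (1 : T) = realOne T c.re + Complex.I • realOne T c.im := by
    rw [realOne, realOne, smul_smul, ← add_smul, mul_comm, Complex.re_add_im]
  rwa [e]

variable [ROStarAlgebra T]

theorem mul_mem_K {x y : T} (hx : x ∈ sumsOfSquares T) (hy : y ∈ sumsOfSquares T)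
    (hxy : x * y = y * x) : x * y ∈ sumsOfSquares T := by
  obtain ⟨a, ha, hax, rfl⟩ := ROStarAlgebra.exists_sqrt x hx
  obtain ⟨b, hb, hby, rfl⟩ := ROStarAlgebra.exists_sqrt y hy
  have h1 : (b * b) * a = a * (b * b) := hax _ (by
    rw [Set.mem_centralizer_iff]; rintro m rfl; exact hxy)
  have h2 : a * b = b * a := hby a (by
    rw [Set.mem_centralizer_iff]; rintro m rfl; exact h1)
  have e : a * a * (b * b) = star (a * b) * (a * b) := by
    rw [star_mul, (isSelfAdjoint_of_mem_K ha).star_eq, (isSelfAdjoint_of_mem_K hb).star_eq, ← h2]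
    calc a * a * (b * b) = a * (a * b) * b := by simp only [mul_assoc]
      _ = a * (b * a) * b := by rw [h2]
      _ = a * b * (a * b) := by simp only [mul_assoc]
  rw [e]; exact star_mul_self_mem_K _

theorem SABound.sq {r : ℝ} {a : T} (h : SABound r a) :
    realOne T (r ^ 2) - a * a ∈ sumsOfSquares T := by
  have e1 : (realOne T r + a) * (realOne T r - a) = realOne T (r ^ 2) - a * a := by
    simp only [realOne, add_mul, mul_sub, smul_mul_assoc, mul_smul_comm, one_mul, mul_one,
      Complex.ofReal_pow]
    module
  have e2 : (realOne T r - a) * (realOne T r + a) = realOne T (r ^ 2) - a * a := by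
    simp only [realOne, sub_mul, mul_add, smul_mul_assoc, mul_smul_comm, one_mul, mul_one,
      Complex.ofReal_pow]
    module
  rw [← e1]
  exact mul_mem_K h.2.2.1 h.2.2.2 (e1.trans e2.symm)

theorem SABound.mul {r s : ℝ} {a b : T} (h : SABound r a) (k : SABound s b) :
    IsBoundedElement (a * b) := by
  have ha := h.2.1
  have hb := k.2.1
  have key := add_mem h.sq k.sq
  have hrs : 0 ≤ r ^ 2 + s ^ 2 := by positivity
  have h1 : SABound (r ^ 2 + s ^ 2) (a * b + b * a) := by
    refine ⟨hrs, ?_, ?_, ?_⟩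
    · simp [IsSelfAdjoint, ha.star_eq, hb.star_eq, add_comm]
    · convert add_mem key (sq_mem_K (ha.add hb)) using 1
      rw [realOne_add]; noncomm_ring
    · convert add_mem key (sq_mem_K (ha.sub hb)) using 1
      rw [realOne_add]; noncomm_ring
  have h2 : SABound (r ^ 2 + s ^ 2) (Complex.I • (a * b - b * a)) := by
    refine ⟨hrs, ?_, ?_, ?_⟩
    · simp [IsSelfAdjoint, ha.star_eq, hb.star_eq, ← smul_neg]
    · convert add_mem key (star_mul_self_mem_K (a + Complex.I • b)) using 1
      have hI : Complex.I • Complex.I • (b * b) = -(b * b) := by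
        rw [smul_smul, Complex.I_mul_I, neg_one_smul]
      simp only [realOne_add, star_add, star_smul, ha.star_eq, hb.star_eq, Complex.star_def,
        Complex.conj_I, add_mul, mul_add, smul_mul_assoc, mul_smul_comm, neg_smul, smul_neg, smul_add,
        smul_sub, neg_mul, hI]
      abel
    · convert add_mem key (star_mul_self_mem_K (a - Complex.I • b)) using 1
      have hI : Complex.I • Complex.I • (b * b) = -(b * b) := by
        rw [smul_smul, Complex.I_mul_I, neg_one_smul]
      simp only [realOne_add, star_sub, star_smul, ha.star_eq, hb.star_eq, Complex.star_def,
        Complex.conj_I, sub_mul, mul_sub, smul_mul_assoc, mul_smul_comm, neg_smul, smul_neg,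
        smul_sub, neg_mul, hI]
      abel
  refine isBoundedElement_iff.2 ⟨_, _, _, _, h1.half, h2.half.neg, ?_⟩
  have hI : Complex.I • (1 / 2 : ℂ) • Complex.I • (a * b - b * a) =
      -((1 / 2 : ℂ) • (a * b - b * a)) := by
    rw [smul_comm, smul_smul Complex.I Complex.I, Complex.I_mul_I, neg_one_smul, smul_neg]
  rw [smul_neg, hI]
  module

theorem IsBoundedElement.mul {x y : T} (hx : IsBoundedElement x) (hy : IsBoundedElement y) :
    IsBoundedElement (x * y) := by
  rw [isBoundedElement_iff] at hx hy
  obtain ⟨r, s, a, b, ha, hb, rfl⟩ := hx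
  obtain ⟨r', s', a', b', ha', hb', rfl⟩ := hy
  have := ((ha.mul ha').add (ha.mul hb').I_smul).add
    ((hb.mul ha').I_smul.add (hb.mul hb').I_smul.I_smul)
  convert this using 1
  simp only [add_mul, mul_add, smul_mul_assoc, mul_smul_comm, smul_add]
  abel

end BoundedElements

/-- The *-subalgebra `M` of all bounded elements of an RO*-algebra `T`. -/
def boundedElements (T : Type*) [Ring T] [StarRing T] [Algebra ℂ T] [StarModule ℂ T]
    [ROStarAlgebra T] : StarSubalgebra ℂ T where
  carrier := {x | IsBoundedElement x}
  mul_mem' := IsBoundedElement.mul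
  add_mem' := IsBoundedElement.add
  algebraMap_mem' c := by
    rw [Algebra.algebraMap_eq_smul_one]; exact isBoundedElement_smul_one c
  star_mem' := IsBoundedElement.star

/-! ### States and the GNS Hilbert space of a unital complex *-algebra -/

/-- A state: a linear functional `φ` with `φ (star x * x) ≥ 0` for all `x` and `φ 1 = 1`. -/
structure StarState (A : Type*) [Ring A] [StarRing A] [Algebra ℂ A] extends A →ₗ[ℂ] ℂ where
  nonneg' : ∀ x : A, 0 ≤ toFun (star x * x)
  one' : toFun 1 = 1

namespace StarState

variable {A : Type*} [Ring A] [StarRing A] [Algebra ℂ A]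

set_option linter.unusedVariables false in
/-- A copy of `A`, to carry the semi-inner product `⟪x, y⟫ = φ (star x * y)`. -/
@[nolint unusedArguments]
def PreGNS (φ : StarState A) : Type _ := A

instance (φ : StarState A) : AddCommGroup φ.PreGNS := inferInstanceAs (AddCommGroup A)
instance (φ : StarState A) : Module ℂ φ.PreGNS := inferInstanceAs (Module ℂ A)

/-- The identity map from `A` to its copy. -/
def toPreGNS (φ : StarState A) : A ≃ₗ[ℂ] φ.PreGNS := LinearEquiv.refl ℂ A

variable [StarModule ℂ A]

theorem conj_symm (φ : StarState A) (x y : A) :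
    (starRingEnd ℂ) (φ.toLinearMap (star y * x)) = φ.toLinearMap (star x * y) := by
  have im : ∀ z : A, (φ.toLinearMap (star z * z)).im = 0 := fun z =>
    ((Complex.nonneg_iff.1 (φ.nonneg' z)).2).symm
  have h1 := im (x + y)
  have h2 := im (x + Complex.I • y)
  have h3 := im x
  have h4 := im y
  simp only [star_add, star_smul, add_mul, mul_add, smul_mul_assoc, mul_smul_comm, map_add,
    map_smul, smul_eq_mul, Complex.star_def, Complex.conj_I, Complex.add_im, Complex.mul_im,
    Complex.mul_re, Complex.neg_re, Complex.neg_im, Complex.I_re, Complex.I_im] at h1 h2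
  apply Complex.ext
  · simp only [Complex.conj_re]; linarith
  · simp only [Complex.conj_im]; linarith

/-- The semi-inner product `⟪x, y⟫ = φ (star x * y)`. -/
abbrev preCore (φ : StarState A) : PreInnerProductSpace.Core ℂ φ.PreGNS where
  inner x y := φ.toLinearMap (star (φ.toPreGNS.symm x) * φ.toPreGNS.symm y)
  conj_inner_symm x y := φ.conj_symm _ _
  re_inner_nonneg x := (Complex.nonneg_iff.1 (φ.nonneg' _)).1
  add_left x y z := by rw [map_add, star_add, add_mul, map_add]
  smul_left x y r := by
    rw [map_smul, star_smul, smul_mul_assoc, map_smul]; rfl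

instance (φ : StarState A) : SeminormedAddCommGroup φ.PreGNS :=
  InnerProductSpace.Core.toSeminormedAddCommGroup (c := φ.preCore)
instance (φ : StarState A) : InnerProductSpace ℂ φ.PreGNS :=
  InnerProductSpace.ofCore φ.preCore

/-- The GNS Hilbert space `H_φ`: the Hausdorff completion of `A` for `⟪x, y⟫ = φ (star x * y)`. -/
abbrev GNS (φ : StarState A) : Type _ := UniformSpace.Completion φ.PreGNS

/-- The canonical map with dense range from `A` to `H_φ`. -/
def toGNS (φ : StarState A) (x : A) : φ.GNS := (φ.toPreGNS x : UniformSpace.Completion φ.PreGNS)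

/-- `ρ` is the GNS representation of `φ`: each `ρ x` is the bounded operator on `H_φ` extending left
multiplication by `x`. (These operators are determined by this, as the image of `A` is dense.) -/
def IsGNSRep (φ : StarState A) (ρ : A →⋆ₐ[ℂ] (φ.GNS →L[ℂ] φ.GNS)) : Prop :=
  ∀ x y : A, ρ x (φ.toGNS y) = φ.toGNS (x * y)

end StarState

/-- The Hilbert sum `⨁ H_φ` of the GNS spaces of all states of `A`. -/
abbrev UniversalGNS (A : Type*) [Ring A] [StarRing A] [Algebra ℂ A] [StarModule ℂ A] : Type _ :=
  lp (fun φ : StarState A => φ.GNS) 2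

/-- `π` is the direct sum of the GNS representations of all states of `A`. -/
def IsUniversalGNSRep {A : Type*} [Ring A] [StarRing A] [Algebra ℂ A] [StarModule ℂ A]
    (π : A →⋆ₐ[ℂ] (UniversalGNS A →L[ℂ] UniversalGNS A)) : Prop :=
  ∃ ρ : (φ : StarState A) → (A →⋆ₐ[ℂ] (φ.GNS →L[ℂ] φ.GNS)),
    (∀ φ : StarState A, φ.IsGNSRep (ρ φ)) ∧ ∀ (x : A) (v : UniversalGNS A) (φ : StarState A),
      (π x v) φ = ρ φ x (v φ)

end

/-! ### The cone of sums of squares: properness, positive parts, the archimedean property -/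

section Order

set_option linter.unusedSectionVars false

variable {T : Type*} [Ring T] [StarRing T]

/-! Everything reduces to the order given by `K`. The Rickart axiom makes the involution proper, and
together with square roots it gives `K ∩ -K = 0` and a projection cutting a self-adjoint element
into positive and negative parts. The Fisher–Riesz axiom then makes `K` archimedean
(`mem_K_of_forall_realOne_add_mem_K`): a negative part `z` lying below every `ε 1` has all multiples
`n z` below a common supremum, which forces `z = 0`. Hence the infimum in the order-unit norm is
attained, the norm is definite and the cone is closed. The same axiom, applied to a shifted series,
yields completeness (`exists_sum_of_summable`).

The C*-norm is `q(x) = ‖x* x‖^(1/2)`, with the order-unit norm on the right, so that `q(x) ≤ r`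
means `x* x ≤ r² 1` (`cstarNorm_le_iff`). The C*-identity is then immediate, and the other norm
properties become explicit identities between elements of the cone. On self-adjoint elements `q` is
the order-unit norm, because `x² ≤ r² 1` and `-r 1 ≤ x ≤ r 1` are equivalent.

For the realisation, `x* x ≤ q(x)² 1` bounds left multiplication by `q(x)` on every GNS space, so
`‖π(x)‖ ≤ q(x)`. Conversely, if `0 ≤ r < q(x)`, then `r² 1 - x* x` is outside `K`, and the Riesz
extension theorem supplies a state `φ` with `φ(x* x) ≥ r²` (`exists_starState_re_nonpos`). The unit
vector of `φ` then shows `‖π(x)‖ ≥ r`. Thus `π` is isometric, hence faithful. -/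

theorem eq_zero_of_star_mul_self_eq_zero [RickartStarRing T] {x : T} (h : star x * x = 0) :
    x = 0 := by
  obtain ⟨e, he, hE⟩ := RickartStarRing.exists_projection (star x)
  have hx : x ∈ {y : T | star x * y = 0} := h
  have hee : e ∈ {y : T | star x * y = 0} := by rw [hE]; exact ⟨1, by simp⟩
  rw [hE] at hx
  obtain ⟨z, hz⟩ := hx
  -- `x` lies in `eT`, so `e` fixes it; but the adjoint of `x* e = 0` says that `e` kills it.
  have h1 : e * x = 0 := by
    have := congrArg star (show star x * e = 0 from hee)
    simpa [he.isSelfAdjoint.star_eq] using this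
  rw [hz, ← mul_assoc, he.isIdempotentElem.eq, ← hz] at h1
  exact h1

variable [Algebra ℂ T] [StarModule ℂ T]

theorem conj_mem_K {x : T} (hx : x ∈ sumsOfSquares T) (y : T) :
    star y * x * y ∈ sumsOfSquares T := by
  induction hx using AddSubmonoid.closure_induction with
  | mem x h =>
    obtain ⟨s, rfl⟩ := h
    simpa [mul_assoc] using star_mul_self_mem_K (s * y)
  | zero => simp
  | add x z _ _ hx hz => rw [mul_add, add_mul]; exact add_mem hx hz

theorem IsStarProjection.mem_K {e : T} (he : IsStarProjection e) : e ∈ sumsOfSquares T := by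
  simpa [he.isIdempotentElem.eq] using sq_mem_K he.isSelfAdjoint

theorem isSelfAdjoint_realOne (r : ℝ) : IsSelfAdjoint (realOne T r) := by
  simp [IsSelfAdjoint, realOne, star_smul]

theorem realOne_sub (r s : ℝ) : realOne T (r - s) = realOne T r - realOne T s := by
  simp [realOne, sub_smul]

theorem mem_K_of_smul_mem_K {x : T} {r : ℝ} (hr : 0 < r)
    (hx : (r : ℂ) • x ∈ sumsOfSquares T) : x ∈ sumsOfSquares T := by
  have := smul_mem_K hx (inv_nonneg.2 hr.le)
  rwa [smul_smul, ← Complex.ofReal_mul, inv_mul_cancel₀ hr.ne', Complex.ofReal_one,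
    one_smul] at this

variable [ROStarAlgebra T]

/-- Write `x = y²` and `-x = z²`. The bicommutant condition makes the self-adjoint roots commute, so
`(y + iz)* (y + iz) = y² + z² = 0`, and properness of the involution gives `y + iz = 0`. Together
with the adjoint equation this yields `y = 0`. -/
theorem eq_zero_of_mem_K_of_neg_mem_K {x : T} (hx : x ∈ sumsOfSquares T)
    (hx' : -x ∈ sumsOfSquares T) : x = 0 := by
  obtain ⟨y, hy, hyx, hy2⟩ := ROStarAlgebra.exists_sqrt x hx
  obtain ⟨z, hz, hzx, hz2⟩ := ROStarAlgebra.exists_sqrt (-x) hx'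
  have hys := isSelfAdjoint_of_mem_K hy
  have hzs := isSelfAdjoint_of_mem_K hz
  have hxz : x * z = z * x := by
    have : x = -(z * z) := by rw [hz2, neg_neg]
    rw [this]; noncomm_ring
  have hyz : z * y = y * z := hyx z (by
    rw [Set.mem_centralizer_iff]; rintro m rfl; exact hxz)
  have h0 : y + Complex.I • z = 0 := by
    apply eq_zero_of_star_mul_self_eq_zero
    simp only [star_add, star_smul, hys.star_eq, hzs.star_eq, Complex.star_def, Complex.conj_I,
      add_mul, mul_add, smul_mul_assoc, mul_smul_comm, hy2, hz2, hyz]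
    simp only [smul_add, smul_smul, smul_neg, neg_smul, Complex.I_mul_I]
    module
  have h1 : y - Complex.I • z = 0 := by
    have := congrArg star h0
    simpa [star_smul, hys.star_eq, hzs.star_eq, sub_eq_add_neg] using this
  have h2 : (2 : ℂ) • y = 0 := by
    have : (2 : ℂ) • y = (y + Complex.I • z) + (y - Complex.I • z) := by module
    rw [this, h0, h1, add_zero]
  have h3 : y = 0 := (smul_eq_zero_iff_right (two_ne_zero : (2 : ℂ) ≠ 0)).1 h2
  rw [← hy2, h3, mul_zero]

/-- A self-adjoint element is cut by a projection commuting with it into its positive and its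
negative part. -/
theorem exists_projection_posPart {x : T} (hx : IsSelfAdjoint x) :
    ∃ e : T, IsStarProjection e ∧ e * x = x * e ∧ x * e ∈ sumsOfSquares T ∧
      x * e - x ∈ sumsOfSquares T := by
  -- `a` plays the role of `|x|`, and `e` that of the projection onto the kernel of `|x| - x`.
  obtain ⟨a, ha, hax, ha2⟩ := ROStarAlgebra.exists_sqrt (x * x) (sq_mem_K hx)
  have has := isSelfAdjoint_of_mem_K ha
  have hc : x * a = a * x := hax x (by
    rw [Set.mem_centralizer_iff]; rintro m rfl; rw [mul_assoc])
  obtain ⟨e, he, hE⟩ := RickartStarRing.exists_projection (a - x)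
  have hee : e ∈ {y : T | (a - x) * y = 0} := by rw [hE]; exact ⟨1, by simp⟩
  have hde : a * e = x * e := by
    have : (a - x) * e = 0 := hee
    rwa [sub_mul, sub_eq_zero] at this
  -- Since `a² = x²`, `e` fixes `a + x`, whereas `(a - x) e = 0`. Hence `x e = a e = (a + x) / 2` is
  -- the positive part, and `x e - x = a (1 - e)` the negative part.
  have hp : a + x ∈ {y : T | (a - x) * y = 0} := by
    change (a - x) * (a + x) = 0
    rw [sub_mul, mul_add, mul_add, ha2, hc]; abel
  rw [hE] at hp
  obtain ⟨z, hz⟩ := hp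
  have hep : e * (a + x) = a + x := by
    rw [hz, ← mul_assoc, he.isIdempotentElem.eq]
  have hpe : (a + x) * e = a + x := by
    have := congrArg star hep
    simpa [he.isSelfAdjoint.star_eq, has.star_eq, hx.star_eq] using this
  have h2 : x * e = (1 / 2 : ℂ) • (a + x) := by
    rw [← hpe, add_mul, hde]; module
  have h3 : e * x = x * e := by
    have h4 := congrArg star h2
    simp only [star_mul, star_smul, star_add, he.isSelfAdjoint.star_eq, has.star_eq,
      hx.star_eq] at h4
    rw [h4, h2]; simp
  have hea : e * a = a * e := by
    have h4 : e * a = e * (a + x) - e * x := by rw [mul_add]; abel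
    rw [h4, hep, h3, hde, h2]; module
  have haeK : x * e ∈ sumsOfSquares T := by
    rw [← hde]; exact mul_mem_K ha he.mem_K hea.symm
  refine ⟨e, he, h3, haeK, ?_⟩
  have he' : (1 - e) ∈ sumsOfSquares T := he.one_sub.mem_K
  have := mul_mem_K ha he' (by rw [mul_sub, sub_mul, hea]; simp)
  convert this using 1
  rw [mul_sub, mul_one, hde, h2]; module

/-- The cone is archimedean. -/
theorem mem_K_of_forall_realOne_add_mem_K {x : T} (hx : IsSelfAdjoint x)
    (h : ∀ ε : ℝ, 0 < ε → realOne T ε + x ∈ sumsOfSquares T) : x ∈ sumsOfSquares T := by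
  obtain ⟨e, he, hc, hpos, hneg⟩ := exists_projection_posPart hx.neg
  -- `z` is the negative part of `x`. Compressing `ε 1 + x ≥ 0` by `e` and adding `ε (1 - e)` gives
  -- `z ≤ ε 1`.
  set z : T := -x * e with hz
  have hzb : ∀ ε : ℝ, 0 < ε → realOne T ε - z ∈ sumsOfSquares T := by
    intro ε hε
    have h1 := conj_mem_K (h ε hε) e
    have h2 : realOne T ε * (1 - e) ∈ sumsOfSquares T := by
      rw [realOne, smul_mul_assoc, one_mul]; exact smul_mem_K he.one_sub.mem_K hε.le
    have e3 : e * x * e = x * e := by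
      have : e * x = x * e := by
        rw [hz, mul_neg, neg_mul, neg_inj] at hc
        exact hc
      rw [this, mul_assoc, he.isIdempotentElem.eq]
    convert add_mem h1 h2 using 1
    rw [he.isSelfAdjoint.star_eq, mul_add, add_mul, e3, hz]
    simp only [realOne, smul_mul_assoc, mul_smul_comm, mul_one, one_mul, mul_sub,
      he.isIdempotentElem.eq, neg_mul]
    module
  have hzs := isSelfAdjoint_of_mem_K hpos
  -- The constant sequence `z` is admissible because `z ≤ 2⁻ⁿ 1` for all `n`; its partial sums are
  -- `n z`.
  obtain ⟨s, hs, hub, hlub⟩ := ROStarAlgebra.exists_sup (fun _ : ℕ => z)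
    (fun n => (1 / 2 : ℝ) ^ n) (fun _ => hzs) (fun n => by positivity)
    (fun n => ⟨by simpa [KLE] using hpos, hzb _ (by positivity)⟩)
    (summable_geometric_of_lt_one (by norm_num) (by norm_num))
  -- From `(n + 1) z ≤ s` for all `n`, the element `s - z` is again an upper bound of the `n z`.
  have h4 : KLE s (s - z) := hlub _ (hs.sub hzs) fun n => by
    have := hub (n + 1)
    rw [Finset.sum_range_succ] at this
    unfold KLE at this ⊢
    convert this using 1; abel
  have h5 : -z ∈ sumsOfSquares T := by
    unfold KLE at h4
    convert h4 using 1; abel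
  have h6 : z = 0 := eq_zero_of_mem_K_of_neg_mem_K hpos h5
  simpa [h6] using hneg

/-! ### Order-unit bounds and convergence of absolutely convergent series -/

theorem SABound.of_forall_gt {x : T} {r : ℝ} (hr : 0 ≤ r) (hx : IsSelfAdjoint x)
    (h : ∀ s, r < s → SABound s x) : SABound r x := by
  refine ⟨hr, hx, ?_, ?_⟩
  · refine mem_K_of_forall_realOne_add_mem_K ((isSelfAdjoint_realOne r).add hx) fun ε hε => ?_
    have := (h (ε + r) (by linarith)).2.2.1
    rwa [realOne_add, add_assoc] at this
  · refine mem_K_of_forall_realOne_add_mem_K ((isSelfAdjoint_realOne r).sub hx) fun ε hε => ?_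
    have := (h (ε + r) (by linarith)).2.2.2
    rwa [realOne_add, add_sub_assoc] at this

/-- For `r > 0` this is the identity `2r (r ± x) = (r² - x²) + (r ± x)²`; for `r = 0` it is
properness. Being the converse of `SABound.sq`, it makes the C*-norm extend the order-unit norm. -/
theorem SABound.of_sq {x : T} {r : ℝ} (hr : 0 ≤ r) (hx : IsSelfAdjoint x)
    (h : realOne T (r ^ 2) - x * x ∈ sumsOfSquares T) : SABound r x := by
  rcases hr.eq_or_lt with rfl | hr'
  · have h0 : x * x = 0 := eq_zero_of_mem_K_of_neg_mem_K (sq_mem_K hx) (by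
      simpa [realOne] using h)
    have : x = 0 := eq_zero_of_star_mul_self_eq_zero (by rw [hx.star_eq, h0])
    subst this
    simp [SABound, realOne]
  · refine ⟨hr, hx, ?_, ?_⟩
    · apply mem_K_of_smul_mem_K (show 0 < 2 * r by positivity)
      convert add_mem h (sq_mem_K ((isSelfAdjoint_realOne r).add hx)) using 1
      simp only [realOne, add_mul, mul_add, smul_mul_assoc, mul_smul_comm, one_mul, mul_one]
      push_cast
      module
    · apply mem_K_of_smul_mem_K (show 0 < 2 * r by positivity)
      convert add_mem h (sq_mem_K ((isSelfAdjoint_realOne r).sub hx)) using 1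
      simp only [realOne, sub_mul, mul_sub, smul_mul_assoc, mul_smul_comm, one_mul, mul_one]
      push_cast
      module

theorem SABound.of_mem_K {x : T} {r : ℝ} (hr : 0 ≤ r) (hx : x ∈ sumsOfSquares T)
    (h : realOne T r - x ∈ sumsOfSquares T) : SABound r x :=
  ⟨hr, isSelfAdjoint_of_mem_K hx, add_mem (realOne_mem_K hr) hx, h⟩

theorem IsBoundedElement.exists_SABound {x : T} (h : IsBoundedElement x) (hx : IsSelfAdjoint x) :
    ∃ r, SABound r x := by
  obtain ⟨r, s, a, b, ha, hb, rfl⟩ := isBoundedElement_iff.1 h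
  have h1 : (2 : ℂ) • (Complex.I • b) = 0 := by
    have := hx.star_eq
    simp only [star_add, star_smul, ha.2.1.star_eq, hb.2.1.star_eq, Complex.star_def,
      Complex.conj_I] at this
    have h2 : (2 : ℂ) • (Complex.I • b) = (a + Complex.I • b) - (a + -Complex.I • b) := by module
    rw [h2, this, sub_self]
  have h2 : Complex.I • b = 0 := (smul_eq_zero_iff_right (two_ne_zero : (2 : ℂ) ≠ 0)).1 h1
  exact ⟨r, by rwa [h2, add_zero]⟩

theorem orderUnitNorm_eq_sInf {x : T} (hx : IsSelfAdjoint x) :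
    orderUnitNorm x = sInf {r : ℝ | SABound r x} := by
  unfold orderUnitNorm
  congr 1
  ext r
  simp [SABound, hx, KLE, add_comm]

theorem SABound.orderUnitNorm_le {x : T} {r : ℝ} (h : SABound r x) : orderUnitNorm x ≤ r := by
  rw [orderUnitNorm_eq_sInf h.2.1]
  exact csInf_le ⟨0, fun _ hs => hs.1⟩ h

theorem orderUnitNorm_nonneg (x : T) : 0 ≤ orderUnitNorm x :=
  Real.sInf_nonneg fun _ h => h.1

/-- The infimum is attained because the cone is archimedean; norm estimates thereby become
membership in the cone. -/
theorem SABound.orderUnitNorm {x : T} {r : ℝ} (h : SABound r x) :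
    SABound (orderUnitNorm x) x := by
  refine SABound.of_forall_gt (orderUnitNorm_nonneg x) h.2.1 fun s hs => ?_
  rw [orderUnitNorm_eq_sInf h.2.1] at hs
  obtain ⟨t, ht, hts⟩ := exists_lt_of_csInf_lt ⟨r, h⟩ hs
  exact SABound.mono ht hts.le

theorem SABound.orderUnitNorm_le_iff {x : T} {s : ℝ} (h : SABound s x) {r : ℝ} :
    _root_.orderUnitNorm x ≤ r ↔ SABound r x :=
  ⟨h.orderUnitNorm.mono, SABound.orderUnitNorm_le⟩

/-- An absolutely convergent series of bounded self-adjoint elements converges. -/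
theorem exists_sum_of_summable (u : ℕ → T) (c : ℕ → ℝ) (hc : Summable c)
    (hu : ∀ n, SABound (c n) (u n)) :
    ∃ s : T, ∀ n, SABound (∑' k, c k - ∑ k ∈ Finset.range n, c k)
      (s - ∑ k ∈ Finset.range n, u k) := by
  have hle : ∀ n, ∑ k ∈ Finset.range n, c k ≤ ∑' k, c k := fun n =>
    hc.sum_le_tsum _ fun k _ => (hu k).1
  have hX : ∀ n, ∑ k ∈ Finset.range n, (realOne T (c k) + u k) =
      realOne T (∑ k ∈ Finset.range n, c k) + ∑ k ∈ Finset.range n, u k := fun n => by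
    rw [Finset.sum_add_distrib]; simp [realOne, Finset.sum_smul]
  have hmono : ∀ (v : ℕ → T), (∀ n, v n ∈ sumsOfSquares T) → ∀ {m n : ℕ}, m ≤ n →
      ∑ k ∈ Finset.range n, v k - ∑ k ∈ Finset.range m, v k ∈ sumsOfSquares T := by
    intro v hv m n hmn
    rw [← Finset.sum_Ico_eq_sub _ hmn]
    exact sum_mem fun k _ => hv k
  -- The Fisher–Riesz axiom needs positive terms, so `u n` is shifted: `0 ≤ c n + u n ≤ 2 c n`. The
  -- sum is the supremum minus `∑' c`.
  obtain ⟨s, hs, hub, hlub⟩ := ROStarAlgebra.exists_sup (fun n => realOne T (c n) + u n)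
    (fun n => 2 * c n) (fun n => (isSelfAdjoint_realOne _).add (hu n).2.1)
    (fun n => mul_nonneg zero_le_two (hu n).1)
    (fun n => ⟨by simpa [KLE] using (hu n).2.2.1, by
      have := (hu n).2.2.2
      unfold KLE
      convert this using 1
      rw [two_mul, realOne_add]; abel⟩) (hc.mul_left 2)
  have hsum : ∀ m, IsSelfAdjoint (∑ k ∈ Finset.range m, u k) := fun m =>
    isSelfAdjoint_sum _ fun k _ => (hu k).2.1
  refine ⟨s - realOne T (∑' k, c k), fun m => ⟨by linarith [hle m],
    (hs.sub (isSelfAdjoint_realOne _)).sub (hsum m), ?_, ?_⟩⟩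
  · have := hub m
    unfold KLE at this
    rw [hX] at this
    convert this using 1
    rw [realOne_sub]; abel
  -- The upper estimate amounts to this element bounding every shifted partial sum. For `n ≤ m` the
  -- positivity of `c k + u k` suffices; for `n ≥ m` that of `c k - u k` does.
  · have h1 := hlub (realOne T (2 * ∑' k, c k - ∑ k ∈ Finset.range m, c k) +
        ∑ k ∈ Finset.range m, u k) ((isSelfAdjoint_realOne _).add (hsum m)) fun n => by
      unfold KLE
      rw [hX]
      rcases le_total n m with h | h
      · have h2 := hmono _ (fun n => (hu n).2.2.1) h
        have h3 : realOne T (2 * (∑' k, c k - ∑ k ∈ Finset.range m, c k)) ∈ sumsOfSquares T :=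
          realOne_mem_K (by linarith [hle m])
        rw [hX, hX] at h2
        convert add_mem h2 h3 using 1
        simp only [realOne]; push_cast; module
      · have h2 := hmono (fun n => realOne T (c n) - u n) (fun n => (hu n).2.2.2) h
        have h3 : realOne T (2 * (∑' k, c k - ∑ k ∈ Finset.range n, c k)) ∈ sumsOfSquares T :=
          realOne_mem_K (by linarith [hle n])
        have e : ∀ n, ∑ k ∈ Finset.range n, (realOne T (c k) - u k) =
            realOne T (∑ k ∈ Finset.range n, c k) - ∑ k ∈ Finset.range n, u k := fun n => by
          rw [Finset.sum_sub_distrib]; simp [realOne, Finset.sum_smul]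
        rw [e, e] at h2
        convert add_mem h2 h3 using 1
        simp only [realOne]; push_cast; module
    unfold KLE at h1
    convert h1 using 1
    simp only [realOne]; push_cast; module

end Order

/-! ### The C*-norm on bounded elements -/

section CStarNorm

set_option linter.unusedSectionVars false

variable {T : Type*} [Ring T] [StarRing T] [Algebra ℂ T] [StarModule ℂ T]

/-- The C*-norm of a bounded element: the square root of the order-unit norm of `star x * x`. -/
noncomputable def cstarNorm (x : T) : ℝ := √(orderUnitNorm (star x * x))

theorem cstarNorm_nonneg (x : T) : 0 ≤ cstarNorm x := Real.sqrt_nonneg _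

variable [ROStarAlgebra T]

namespace IsBoundedElement

variable {x y : T}

theorem cstarNorm_le_iff (hx : IsBoundedElement x) {r : ℝ} (hr : 0 ≤ r) :
    cstarNorm x ≤ r ↔ realOne T (r ^ 2) - Star.star x * x ∈ sumsOfSquares T := by
  obtain ⟨s, hs⟩ := (hx.star.mul hx).exists_SABound (IsSelfAdjoint.star_mul_self x)
  rw [cstarNorm, Real.sqrt_le_left hr, hs.orderUnitNorm_le_iff]
  exact ⟨fun h => h.2.2.2, SABound.of_mem_K (sq_nonneg r) (star_mul_self_mem_K x)⟩

theorem realOne_sub_mem_K (hx : IsBoundedElement x) :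
    realOne T (cstarNorm x ^ 2) - Star.star x * x ∈ sumsOfSquares T :=
  (hx.cstarNorm_le_iff (cstarNorm_nonneg x)).1 le_rfl

theorem cstarNorm_eq_orderUnitNorm (hx : IsBoundedElement x) (hs : IsSelfAdjoint x) :
    cstarNorm x = orderUnitNorm x := by
  obtain ⟨s, hb⟩ := hx.exists_SABound hs
  refine eq_of_forall_ge_iff fun r => ?_
  by_cases hr : 0 ≤ r
  · rw [hx.cstarNorm_le_iff hr, hb.orderUnitNorm_le_iff, hs.star_eq]
    exact ⟨SABound.of_sq hr hs, SABound.sq⟩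
  · exact iff_of_false (fun h => hr ((cstarNorm_nonneg x).trans h))
      (fun h => hr ((orderUnitNorm_nonneg x).trans h))

theorem sABound_cstarNorm (hx : IsBoundedElement x) (hs : IsSelfAdjoint x) :
    SABound (cstarNorm x) x := by
  obtain ⟨s, hb⟩ := hx.exists_SABound hs
  rw [hx.cstarNorm_eq_orderUnitNorm hs]
  exact hb.orderUnitNorm

theorem cstarNorm_star_mul_self (hx : IsBoundedElement x) :
    cstarNorm (Star.star x * x) = cstarNorm x * cstarNorm x := by
  rw [(hx.star.mul hx).cstarNorm_eq_orderUnitNorm (IsSelfAdjoint.star_mul_self x), cstarNorm,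
    Real.mul_self_sqrt (orderUnitNorm_nonneg _)]

theorem eq_zero_of_cstarNorm_eq_zero (hx : IsBoundedElement x) (h : cstarNorm x = 0) : x = 0 := by
  have h1 := hx.realOne_sub_mem_K
  rw [h] at h1
  exact eq_zero_of_star_mul_self_eq_zero
    (eq_zero_of_mem_K_of_neg_mem_K (star_mul_self_mem_K x) (by simpa [realOne] using h1))

/-- `y* (x* x) y ≤ ‖x‖² y* y ≤ ‖x‖² ‖y‖²`, the first step by conjugation with `y`. -/
theorem cstarNorm_mul_le (hx : IsBoundedElement x) (hy : IsBoundedElement y) :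
    cstarNorm (x * y) ≤ cstarNorm x * cstarNorm y := by
  rw [(hx.mul hy).cstarNorm_le_iff (mul_nonneg (cstarNorm_nonneg x) (cstarNorm_nonneg y))]
  convert add_mem (conj_mem_K hx.realOne_sub_mem_K y)
    (smul_mem_K hy.realOne_sub_mem_K (sq_nonneg (cstarNorm x))) using 1
  simp only [realOne, star_mul, mul_sub, sub_mul, smul_mul_assoc, mul_smul_comm, mul_one,
    mul_assoc, smul_sub, smul_smul, mul_pow]
  push_cast
  module

theorem cstarNorm_add_le (hx : IsBoundedElement x) (hy : IsBoundedElement y) :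
    cstarNorm (x + y) ≤ cstarNorm x + cstarNorm y := by
  have key : ∀ r s : ℝ, 0 < r → 0 < s → cstarNorm x ≤ r → cstarNorm y ≤ s →
      cstarNorm (x + y) ≤ r + s := by
    intro r s hr hs hxr hys
    rw [hx.cstarNorm_le_iff hr.le] at hxr
    rw [hy.cstarNorm_le_iff hs.le] at hys
    rw [(hx.add hy).cstarNorm_le_iff (by positivity)]
    -- The identity behind the triangle inequality is `rs ((r+s)² - (x+y)*(x+y)) = (r+s)s (r² - x*
    -- x) + (r+s)r (s² - y* y) + (sx - ry)*(sx - ry)`. Dividing by `rs` is why `r` and `s` are taken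
    -- strictly positive.
    apply mem_K_of_smul_mem_K (show 0 < r * s by positivity)
    have h1 := smul_mem_K hxr (show 0 ≤ (r + s) * s by positivity)
    have h2 := smul_mem_K hys (show 0 ≤ (r + s) * r by positivity)
    have h3 := star_mul_self_mem_K ((s : ℂ) • x - (r : ℂ) • y)
    convert add_mem (add_mem h1 h2) h3 using 1
    simp only [realOne, star_add, star_sub, star_smul, Complex.star_def, Complex.conj_ofReal,
      mul_sub, sub_mul, mul_add, add_mul, smul_mul_assoc, mul_smul_comm]
    push_cast
    module
  refine le_of_forall_pos_le_add fun ε hε => ?_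
  have h0 := cstarNorm_nonneg x
  have h1 := cstarNorm_nonneg y
  have := key (cstarNorm x + ε / 2) (cstarNorm y + ε / 2) (by positivity) (by positivity)
    (by linarith) (by linarith)
  linarith

theorem smul (hx : IsBoundedElement x) (c : ℂ) : IsBoundedElement (c • x) := by
  simpa using (isBoundedElement_smul_one c).mul hx

theorem cstarNorm_smul_le (hx : IsBoundedElement x) (c : ℂ) :
    cstarNorm (c • x) ≤ ‖c‖ * cstarNorm x := by
  rw [(hx.smul c).cstarNorm_le_iff (mul_nonneg (norm_nonneg c) (cstarNorm_nonneg x))]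
  convert smul_mem_K hx.realOne_sub_mem_K (sq_nonneg ‖c‖) using 1
  have : ((‖c‖ ^ 2 : ℝ) : ℂ) = Star.star c * c := by
    rw [Complex.star_def, mul_comm, Complex.mul_conj, Complex.normSq_eq_norm_sq]
  simp only [realOne, star_smul, smul_mul_assoc, mul_smul_comm, mul_pow, smul_sub]
  rw [Complex.ofReal_mul, this]
  module

theorem cstarNorm_smul (hx : IsBoundedElement x) (c : ℂ) :
    cstarNorm (c • x) = ‖c‖ * cstarNorm x := by
  rcases eq_or_ne c 0 with rfl | hc
  · refine le_antisymm (hx.cstarNorm_smul_le 0) ?_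
    simpa using cstarNorm_nonneg _
  refine le_antisymm (hx.cstarNorm_smul_le c) ?_
  have := (hx.smul c).cstarNorm_smul_le c⁻¹
  rw [smul_smul, inv_mul_cancel₀ hc, one_smul, norm_inv] at this
  rwa [← le_inv_mul_iff₀ (norm_pos_iff.2 hc)]

theorem cstarNorm_star_le (hx : IsBoundedElement x) : cstarNorm x ≤ cstarNorm (Star.star x) := by
  have h := hx.star.cstarNorm_mul_le hx
  rw [hx.cstarNorm_star_mul_self] at h
  rcases (cstarNorm_nonneg x).eq_or_lt with h0 | h0
  · rw [← h0]; exact cstarNorm_nonneg _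
  · exact le_of_mul_le_mul_right h h0

theorem cstarNorm_star (hx : IsBoundedElement x) : cstarNorm (Star.star x) = cstarNorm x :=
  le_antisymm (by simpa using hx.star.cstarNorm_star_le) hx.cstarNorm_star_le

/-- The root supplied by the axiom lives in `T`; that it is bounded makes positivity in `T` and in
`M` agree, as is needed for states defined on `M` only. -/
theorem exists_sqrt_mem_K (hx : IsBoundedElement x) (hK : x ∈ sumsOfSquares T) :
    ∃ w, IsBoundedElement w ∧ IsSelfAdjoint w ∧ w * w = x := by
  obtain ⟨w, hw, -, rfl⟩ := ROStarAlgebra.exists_sqrt x hK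
  have hws := isSelfAdjoint_of_mem_K hw
  obtain ⟨s, hs⟩ := hx.exists_SABound (isSelfAdjoint_of_mem_K hK)
  -- `s + 1` is merely a convenient number whose square dominates `s`.
  have h := (hs.mono (show s ≤ (s + 1) ^ 2 by nlinarith [hs.1])).2.2.2
  exact ⟨w, (SABound.of_sq (by linarith [hs.1]) hws h).isBoundedElement, hws, rfl⟩

end IsBoundedElement

theorem SABound.cstarNorm_le {x : T} {r : ℝ} (h : SABound r x) : cstarNorm x ≤ r := by
  rw [h.isBoundedElement.cstarNorm_eq_orderUnitNorm h.2.1]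
  exact h.orderUnitNorm_le

variable (T)

/-- `cstarNorm` as an algebra norm on the bounded elements. -/
noncomputable def boundedElementsNorm : AlgebraNorm ℂ (boundedElements T) where
  toFun x := cstarNorm (x : T)
  map_zero' := by simp [cstarNorm, (show SABound (T := T) 0 0 by simp [SABound, realOne])
    |>.orderUnitNorm_le.antisymm (orderUnitNorm_nonneg _)]
  add_le' x y := IsBoundedElement.cstarNorm_add_le x.2 y.2
  neg' x := by simp [cstarNorm]
  mul_le' x y := IsBoundedElement.cstarNorm_mul_le x.2 y.2
  eq_zero_of_map_eq_zero' x h := Subtype.ext (IsBoundedElement.eq_zero_of_cstarNorm_eq_zero x.2 h)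
  smul' c x := IsBoundedElement.cstarNorm_smul x.2 c

/-- The order-unit norm on the self-adjoint bounded elements. -/
noncomputable def selfAdjointNorm : AddGroupNorm (selfAdjoint (boundedElements T)) where
  toFun x := boundedElementsNorm T x
  map_zero' := by simp
  add_le' x y := map_add_le_add (boundedElementsNorm T) _ _
  neg' x := by simp
  eq_zero_of_map_eq_zero' x h := Subtype.ext (eq_zero_of_map_eq_zero (boundedElementsNorm T) h)

variable {T}

theorem isSelfAdjoint_coe (x : selfAdjoint (boundedElements T)) :
    IsSelfAdjoint ((x : boundedElements T) : T) :=
  congrArg Subtype.val x.2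

theorem boundedElementsNorm_selfAdjoint (x : selfAdjoint (boundedElements T)) :
    boundedElementsNorm T x = orderUnitNorm (x : T) :=
  IsBoundedElement.cstarNorm_eq_orderUnitNorm x.1.2 (isSelfAdjoint_coe x)

theorem selfAdjointNorm_smul (r : ℝ) (x : selfAdjoint (boundedElements T)) :
    selfAdjointNorm T (r • x) = |r| * selfAdjointNorm T x := by
  have := map_smul_eq_mul (boundedElementsNorm T) (r : ℂ) (x : boundedElements T)
  rwa [Complex.norm_real, Real.norm_eq_abs] at this

/-! ### Completeness and closedness of the cone -/

open Filter Topology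

theorem tendsto_tsum_sub_sum {c : ℕ → ℝ} (hc : Summable c) :
    Tendsto (fun n => ∑' k, c k - ∑ k ∈ Finset.range n, c k) atTop (𝓝 0) := by
  simpa using hc.hasSum.tendsto_sum_nat.const_sub (∑' k, c k)

theorem completeSpace_selfAdjoint :
    letI := (selfAdjointNorm T).toNormedAddCommGroup
    CompleteSpace (selfAdjoint (boundedElements T)) := by
  let := (selfAdjointNorm T).toNormedAddCommGroup
  refine NormedAddCommGroup.completeSpace_of_summable_imp_tendsto fun u hu => ?_
  obtain ⟨s, hs⟩ := exists_sum_of_summable (fun n => ((u n : boundedElements T) : T))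
    (fun n => ‖u n‖) hu fun n => IsBoundedElement.sABound_cstarNorm (u n).1.2 (isSelfAdjoint_coe _)
  have hs0 := hs 0
  simp only [Finset.range_zero, Finset.sum_empty, sub_zero] at hs0
  refine ⟨⟨⟨s, hs0.isBoundedElement⟩, Subtype.ext hs0.2.1⟩, ?_⟩
  rw [tendsto_iff_norm_sub_tendsto_zero]
  refine squeeze_zero (fun _ => norm_nonneg _) (fun n => ?_) (tendsto_tsum_sub_sum hu)
  rw [norm_sub_rev]
  refine SABound.cstarNorm_le ?_
  convert hs n
  simp

theorem isClosed_selfAdjoint_nonneg :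
    letI := (selfAdjointNorm T).toNormedAddCommGroup
    IsClosed {x : selfAdjoint (boundedElements T) | KLE 0 (x : T)} := by
  let := (selfAdjointNorm T).toNormedAddCommGroup
  refine isClosed_of_closure_subset fun x hx => ?_
  change KLE 0 ((x : boundedElements T) : T)
  unfold KLE
  rw [sub_zero]
  refine mem_K_of_forall_realOne_add_mem_K (isSelfAdjoint_coe x) fun ε hε => ?_
  obtain ⟨y, hy, hxy⟩ := Metric.mem_closure_iff.1 hx ε hε
  rw [dist_eq_norm] at hxy
  have h1 : SABound ‖x - y‖ _ :=
    IsBoundedElement.sABound_cstarNorm (x - y).1.2 (isSelfAdjoint_coe (x - y))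
  have h2 := (h1.mono hxy.le).2.2.1
  have h3 : ((y : boundedElements T) : T) ∈ sumsOfSquares T := by
    simpa [KLE] using hy
  -- `ε 1 + x` is the sum of `ε 1 + (x - y) ≥ 0` and `y ≥ 0`.
  convert add_mem h2 h3 using 1
  rw [add_assoc]
  simp

theorem completeSpace_boundedElements :
    letI := (boundedElementsNorm T).toNormedRing
    CompleteSpace (boundedElements T) := by
  let := (boundedElementsNorm T).toNormedRing
  have key : ∀ v : ℕ → boundedElements T, (∀ n, IsSelfAdjoint (v n)) → Summable (‖v ·‖) →
      ∃ a, Tendsto (fun n => ∑ i ∈ Finset.range n, v i) atTop (𝓝 a) := by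
    intro u hsa hu
    obtain ⟨s, hs⟩ := exists_sum_of_summable (fun n => (u n : T))
      (fun n => ‖u n‖) hu fun n => IsBoundedElement.sABound_cstarNorm (u n).2
        (congrArg Subtype.val (hsa n))
    have hs0 := hs 0
    simp only [Finset.range_zero, Finset.sum_empty, sub_zero] at hs0
    refine ⟨⟨s, hs0.isBoundedElement⟩, ?_⟩
    rw [tendsto_iff_norm_sub_tendsto_zero]
    refine squeeze_zero (fun _ => norm_nonneg _) (fun n => ?_) (tendsto_tsum_sub_sum hu)
    rw [norm_sub_rev]
    refine SABound.cstarNorm_le ?_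
    convert hs n
    simp
  have hsmul : ∀ (c : ℂ) (x : boundedElements T), ‖c • x‖ = ‖c‖ * ‖x‖ :=
    map_smul_eq_mul (boundedElementsNorm T)
  have hstar : ∀ x : boundedElements T, ‖star x‖ = ‖x‖ := fun x =>
    IsBoundedElement.cstarNorm_star x.2
  refine NormedAddCommGroup.completeSpace_of_summable_imp_tendsto fun u hu => ?_
  have hstaru : Summable fun n => ‖star (u n)‖ := by simpa only [hstar] using hu
  -- Twice the real and imaginary parts are summed separately, whence the factor `1 / 2` in the
  -- limit.
  obtain ⟨a, ha⟩ := key (fun n => u n + star (u n)) (fun n => IsSelfAdjoint.add_star_self _)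
    (Summable.of_nonneg_of_le (fun _ => norm_nonneg _) (fun _ => norm_add_le _ _) (hu.add hstaru))
  obtain ⟨b, hb⟩ := key (fun n => Complex.I • (star (u n) - u n))
    (fun n => by simp [IsSelfAdjoint, star_smul, ← smul_neg])
    (Summable.of_nonneg_of_le (fun _ => norm_nonneg _) (fun n => by
      rw [hsmul, Complex.norm_I, one_mul]; exact norm_sub_le _ _) (hstaru.add hu))
  let : NormedSpace ℂ (boundedElements T) := ⟨fun c x => (hsmul c x).le⟩
  refine ⟨(1 / 2 : ℂ) • (a + Complex.I • b), ?_⟩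
  convert (ha.add (hb.const_smul Complex.I)).const_smul (1 / 2 : ℂ) using 2 with n
  rw [Finset.smul_sum, ← Finset.sum_add_distrib, Finset.smul_sum]
  refine Finset.sum_congr rfl fun k _ => ?_
  rw [smul_smul, Complex.I_mul_I]
  module

theorem cStarRing_boundedElements :
    letI := (boundedElementsNorm T).toNormedRing
    CStarRing (boundedElements T) := by
  let := (boundedElementsNorm T).toNormedRing
  exact ⟨fun x => (IsBoundedElement.cstarNorm_star_mul_self x.2).ge⟩

end CStarNorm

/-! ### GNS representations, their direct sum, and extension of real functionals to states -/

section GNS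

set_option linter.unusedSectionVars false

variable {A : Type*} [Ring A] [StarRing A] [Algebra ℂ A] [StarModule ℂ A]

namespace StarState

theorem inner_toPreGNS (φ : StarState A) (x y : A) :
    ⟪φ.toPreGNS x, φ.toPreGNS y⟫_ℂ = φ.toLinearMap (star x * y) := rfl

theorem norm_toPreGNS_sq (φ : StarState A) (x : A) :
    ‖φ.toPreGNS x‖ ^ 2 = (φ.toLinearMap (star x * x)).re := by
  rw [InnerProductSpace.norm_sq_eq_re_inner (𝕜 := ℂ), inner_toPreGNS]; rfl

theorem norm_toGNS_sq (φ : StarState A) (x : A) :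
    ‖φ.toGNS x‖ ^ 2 = (φ.toLinearMap (star x * x)).re := by
  rw [toGNS, UniformSpace.Completion.norm_coe, norm_toPreGNS_sq]

theorem norm_toGNS_one (φ : StarState A) : ‖φ.toGNS 1‖ = 1 := by
  have h : φ.toLinearMap 1 = 1 := φ.one'
  have := φ.norm_toGNS_sq 1
  rw [star_one, one_mul, h, Complex.one_re] at this
  exact (pow_eq_one_iff_of_nonneg (norm_nonneg _) two_ne_zero).1 this

theorem ext_toGNS {φ : StarState A} {S R : φ.GNS →L[ℂ] φ.GNS}
    (h : ∀ y, S (φ.toGNS y) = R (φ.toGNS y)) : S = R := by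
  refine ContinuousLinearMap.ext fun v => ?_
  induction v using UniformSpace.Completion.induction_on with
  | hp => exact isClosed_eq S.continuous R.continuous
  | ih y => exact h (φ.toPreGNS.symm y)

theorem toGNS_add (φ : StarState A) (x y : A) : φ.toGNS (x + y) = φ.toGNS x + φ.toGNS y := by
  rw [toGNS, map_add, UniformSpace.Completion.coe_add]; rfl

theorem toGNS_smul (φ : StarState A) (c : ℂ) (x : A) : φ.toGNS (c • x) = c • φ.toGNS x := by
  rw [toGNS, map_smul, UniformSpace.Completion.coe_smul]; rfl

theorem inner_toGNS (φ : StarState A) (x y : A) :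
    ⟪φ.toGNS x, φ.toGNS y⟫_ℂ = φ.toLinearMap (star x * y) := by
  rw [toGNS, toGNS, UniformSpace.Completion.inner_coe, inner_toPreGNS]

/-- Left multiplication by `x`, extended to the GNS space. -/
noncomputable def leftMulGNS (φ : StarState A) (x : A) (C : ℝ)
    (h : ∀ y, ‖φ.toPreGNS (x * y)‖ ≤ C * ‖φ.toPreGNS y‖) : φ.GNS →L[ℂ] φ.GNS :=
  ((φ.toPreGNS.toLinearMap ∘ₗ LinearMap.mulLeft ℂ x ∘ₗ φ.toPreGNS.symm.toLinearMap).mkContinuous C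
    fun y => h (φ.toPreGNS.symm y)).completion

theorem leftMulGNS_toGNS (φ : StarState A) (x : A) (C : ℝ)
    (h : ∀ y, ‖φ.toPreGNS (x * y)‖ ≤ C * ‖φ.toPreGNS y‖) (y : A) :
    φ.leftMulGNS x C h (φ.toGNS y) = φ.toGNS (x * y) := by
  rw [leftMulGNS, toGNS, ContinuousLinearMap.completion_apply_coe]; rfl

theorem norm_leftMulGNS_le (φ : StarState A) (x : A) (C : ℝ) (hC : 0 ≤ C)
    (h : ∀ y, ‖φ.toPreGNS (x * y)‖ ≤ C * ‖φ.toPreGNS y‖) : ‖φ.leftMulGNS x C h‖ ≤ C := by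
  refine ContinuousLinearMap.opNorm_le_bound _ hC fun v => ?_
  induction v using UniformSpace.Completion.induction_on with
  | hp => exact isClosed_le (by fun_prop) (by fun_prop)
  | ih y =>
    have := φ.leftMulGNS_toGNS x C h (φ.toPreGNS.symm y)
    rw [toGNS, toGNS, LinearEquiv.apply_symm_apply] at this
    rw [this, UniformSpace.Completion.norm_coe, UniformSpace.Completion.norm_coe]
    exact h (φ.toPreGNS.symm y)

/-- The GNS representation exists as soon as left multiplications are bounded. -/
theorem exists_isGNSRep (φ : StarState A) (N : A → ℝ) (hN : ∀ x, 0 ≤ N x)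
    (h : ∀ x y, ‖φ.toPreGNS (x * y)‖ ≤ N x * ‖φ.toPreGNS y‖) :
    ∃ ρ : A →⋆ₐ[ℂ] (φ.GNS →L[ℂ] φ.GNS), φ.IsGNSRep ρ ∧ ∀ x, ‖ρ x‖ ≤ N x := by
  have key : ∀ x y, φ.leftMulGNS x (N x) (h x) (φ.toGNS y) = φ.toGNS (x * y) := fun x =>
    φ.leftMulGNS_toGNS x _ _
  let ρ : A →⋆ₐ[ℂ] (φ.GNS →L[ℂ] φ.GNS) :=
    { toFun x := φ.leftMulGNS x (N x) (h x)
      map_one' := ext_toGNS fun y => by rw [key, one_mul]; rfl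
      map_mul' x z := ext_toGNS fun y => by
        rw [key, mul_apply_eq_comp, key, key, mul_assoc]
      map_zero' := ext_toGNS fun y => by
        rw [key, ← zero_smul ℂ (0 : A), smul_mul_assoc, toGNS_smul, zero_smul]; rfl
      map_add' x z := ext_toGNS fun y => by
        rw [key, add_apply, key, key, add_mul, toGNS_add]
      commutes' c := ext_toGNS fun y => by
        rw [key, ← Algebra.smul_def, toGNS_smul, Algebra.algebraMap_eq_smul_one]; rfl
      map_star' x := by
        rw [ContinuousLinearMap.star_eq_adjoint, ContinuousLinearMap.eq_adjoint_iff]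
        intro v w
        -- By continuity it suffices to test on the dense image of `A`, where both sides are `φ(y* x
        -- z)`.
        induction v, w using UniformSpace.Completion.induction_on₂ with
        | hp => exact isClosed_eq (by fun_prop) (by fun_prop)
        | ih y z =>
          change ⟪_, φ.toGNS (φ.toPreGNS.symm z)⟫_ℂ = ⟪φ.toGNS (φ.toPreGNS.symm y), _⟫_ℂ
          change ⟪φ.leftMulGNS (star x) _ (h _) (φ.toGNS (φ.toPreGNS.symm y)), _⟫_ℂ =
            ⟪_, φ.leftMulGNS x _ (h _) (φ.toGNS (φ.toPreGNS.symm z))⟫_ℂ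
          rw [key, key, inner_toGNS, inner_toGNS, star_mul, star_star, mul_assoc] }
  exact ⟨ρ, key, fun x => φ.norm_leftMulGNS_le x _ (hN x) (h x)⟩

end StarState

/-- The direct sum of a family of uniformly bounded representations on Hilbert spaces. -/
theorem exists_lp_starAlgHom {ι : Type*} {G : ι → Type*} [∀ i, NormedAddCommGroup (G i)]
    [∀ i, InnerProductSpace ℂ (G i)] [∀ i, CompleteSpace (G i)]
    (ρ : ∀ i, A →⋆ₐ[ℂ] (G i →L[ℂ] G i)) (N : A → ℝ) (hN : ∀ x, 0 ≤ N x)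
    (h : ∀ i x, ‖ρ i x‖ ≤ N x) :
    ∃ π : A →⋆ₐ[ℂ] (lp G 2 →L[ℂ] lp G 2),
      (∀ x v i, (π x v) i = ρ i x (v i)) ∧ ∀ x, ‖π x‖ ≤ N x := by
  -- Coordinatewise comparison with `N x • v` gives both square-summability of the image and the
  -- operator bound.
  have hle : ∀ x (v : lp G 2) i, ‖ρ i x (v i)‖ ≤ ‖((N x : ℂ) • v) i‖ := fun x v i => by
    rw [lp.coeFn_smul, Pi.smul_apply, norm_smul, Complex.norm_real, Real.norm_of_nonneg (hN x)]
    exact (ρ i x).le_of_opNorm_le (h i x) _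
  let L₀ : A → (lp G 2 →ₗ[ℂ] lp G 2) := fun x =>
    { toFun := fun v => ⟨fun i => ρ i x (v i), (lp.memℓp ((N x : ℂ) • v)).mono' (hle x v)⟩
      map_add' := fun v w => lp.ext <| funext fun i => map_add (ρ i x) (v i) (w i)
      map_smul' := fun c v => lp.ext <| funext fun i => map_smul (ρ i x) c (v i) }
  have hLN : ∀ x v, ‖L₀ x v‖ ≤ N x * ‖v‖ := fun x v => by
    refine (lp.norm_mono two_ne_zero (y := (N x : ℂ) • v) (hle x v)).trans ?_
    rw [norm_smul, Complex.norm_real, Real.norm_of_nonneg (hN x)]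
  let L : A → (lp G 2 →L[ℂ] lp G 2) := fun x => (L₀ x).mkContinuous (N x) (hLN x)
  have hL : ∀ x v i, (L x v) i = ρ i x (v i) := fun x v i => rfl
  have ext : ∀ {S R : lp G 2 →L[ℂ] lp G 2}, (∀ v i, S v i = R v i) → S = R := fun H =>
    ContinuousLinearMap.ext fun v => lp.ext <| funext fun i => H v i
  let π : A →⋆ₐ[ℂ] (lp G 2 →L[ℂ] lp G 2) :=
    { toFun := L
      map_one' := ext fun v i => by rw [hL, map_one]; rfl
      map_mul' x y := ext fun v i => by
        rw [hL, map_mul, mul_apply_eq_comp, mul_apply_eq_comp, hL, hL]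
      map_zero' := ext fun v i => by rw [hL, map_zero]; rfl
      map_add' x y := ext fun v i => by rw [hL, map_add]; rfl
      commutes' c := ext fun v i => by
        rw [hL, AlgHomClass.commutes, Algebra.algebraMap_eq_smul_one,
          Algebra.algebraMap_eq_smul_one]; rfl
      map_star' x := by
        rw [ContinuousLinearMap.star_eq_adjoint, ContinuousLinearMap.eq_adjoint_iff]
        intro v w
        rw [lp.inner_eq_tsum, lp.inner_eq_tsum]
        refine tsum_congr fun i => ?_
        rw [hL, hL, map_star, ContinuousLinearMap.star_eq_adjoint,
          ContinuousLinearMap.adjoint_inner_left] }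
  exact ⟨π, hL, fun x => (L x).opNorm_le_bound (hN x) (hLN x)⟩

theorem exists_isUniversalGNSRep (N : A → ℝ) (hN : ∀ x, 0 ≤ N x)
    (h : ∀ (φ : StarState A) (x y : A), ‖φ.toPreGNS (x * y)‖ ≤ N x * ‖φ.toPreGNS y‖) :
    ∃ π : A →⋆ₐ[ℂ] (UniversalGNS A →L[ℂ] UniversalGNS A),
      IsUniversalGNSRep π ∧ ∀ x, ‖π x‖ ≤ N x := by
  choose ρ hρ hρN using fun φ : StarState A => φ.exists_isGNSRep N hN (h φ)
  obtain ⟨π, hπ, hπN⟩ := exists_lp_starAlgHom ρ N hN hρN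
  exact ⟨π, ⟨ρ, hρ, hπ⟩, hπN⟩

/-- Apply `π x` to the unit vector given by the class of `1` in the summand of `φ`: the result has
`φ`-coordinate the class of `x`, of squared norm `φ(x* x)`. -/
theorem IsUniversalGNSRep.re_apply_le {π : A →⋆ₐ[ℂ] (UniversalGNS A →L[ℂ] UniversalGNS A)}
    (hπ : IsUniversalGNSRep π) (φ : StarState A) (x : A) :
    (φ.toLinearMap (star x * x)).re ≤ ‖π x‖ ^ 2 := by
  classical
  obtain ⟨ρ, hρ, hπρ⟩ := hπ
  have h1 := lp.norm_apply_le_norm two_ne_zero (π x (lp.single 2 φ (φ.toGNS 1))) φ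
  rw [hπρ, lp.single_apply_self, hρ, mul_one] at h1
  have h2 := (π x).le_opNorm (lp.single 2 φ (φ.toGNS 1))
  rw [lp.norm_single two_pos, φ.norm_toGNS_one, mul_one] at h2
  rw [← φ.norm_toGNS_sq]
  exact pow_le_pow_left₀ (norm_nonneg _) (h1.trans h2) 2

open ComplexStarModule in
/-- The complex-linear extension of a positive normalized real functional on the self-adjoint
part. -/
theorem exists_starState_of_selfAdjoint (g : selfAdjoint A →ₗ[ℝ] ℝ) (h1 : g 1 = 1)
    (hg : ∀ x : A, 0 ≤ g ⟨star x * x, IsSelfAdjoint.star_mul_self x⟩) :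
    ∃ φ : StarState A, ∀ x : selfAdjoint A, φ.toLinearMap x = g x := by
  let F : A →ₗ[ℂ] ℂ :=
    { toFun x := (g (ℜ x) : ℂ) + Complex.I * g (ℑ x)
      map_add' x y := by simp only [map_add]; push_cast; ring
      map_smul' c x := by
        simp only [realPart_smul, imaginaryPart_smul, map_add, map_sub, map_smul, smul_eq_mul,
          RingHom.id_apply]
        push_cast
        nth_rewrite 5 [← Complex.re_add_im c]
        linear_combination (-(c.im : ℂ) * g (ℑ x)) * Complex.I_mul_I }
  have hF : ∀ x : selfAdjoint A, F x = g x := fun x => by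
    change (g (ℜ (x : A)) : ℂ) + Complex.I * g (ℑ (x : A)) = g x
    rw [selfAdjoint.realPart_coe, x.2.imaginaryPart]
    simp
  refine ⟨⟨F, fun x => ?_, ?_⟩, hF⟩
  · change 0 ≤ F _
    rw [hF ⟨star x * x, IsSelfAdjoint.star_mul_self x⟩]
    exact_mod_cast hg x
  · change F _ = 1
    rw [← selfAdjoint.val_one, hF, h1, Complex.ofReal_one]

end GNS

/-! ### States of the bounded elements and isometry of the universal representation -/

section BoundedStates

variable {T : Type*} [Ring T] [StarRing T] [Algebra ℂ T] [StarModule ℂ T] [ROStarAlgebra T]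

theorem coe_boundedElements_mem_K_iff {x : boundedElements T} :
    (x : T) ∈ sumsOfSquares T ↔ ∃ w : boundedElements T, star w * w = x := by
  constructor
  · intro hx
    obtain ⟨w, hw, hws, hwx⟩ := IsBoundedElement.exists_sqrt_mem_K x.2 hx
    refine ⟨⟨w, hw⟩, Subtype.ext ?_⟩
    change star w * w = x
    rw [hws.star_eq, hwx]
  · rintro ⟨w, rfl⟩
    exact star_mul_self_mem_K (w : T)

/-- `r² 1 - x* x = w* w` with `w` bounded, so `φ((wy)* (wy)) ≥ 0` reads `φ((xy)* (xy)) ≤ r² φ(y*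
y)`. -/
theorem StarState.norm_toPreGNS_mul_le (φ : StarState (boundedElements T))
    (x y : boundedElements T) :
    ‖φ.toPreGNS (x * y)‖ ≤ boundedElementsNorm T x * ‖φ.toPreGNS y‖ := by
  have hx := IsBoundedElement.realOne_sub_mem_K x.2
  set r := boundedElementsNorm T x with hr
  obtain ⟨w, hw⟩ := coe_boundedElements_mem_K_iff.1
    (show ((((r ^ 2 : ℝ) : ℂ) • 1 - star x * x : boundedElements T) : T) ∈ sumsOfSquares T from hx)
  have h0 := (Complex.nonneg_iff.1 (φ.nonneg' (w * y))).1
  change 0 ≤ (φ.toLinearMap (star (w * y) * (w * y))).re at h0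
  have e : star (w * y) * (w * y) =
      ((r ^ 2 : ℝ) : ℂ) • (star y * y) - star (x * y) * (x * y) := by
    calc star (w * y) * (w * y) = star y * (star w * w) * y := by simp only [star_mul, mul_assoc]
      _ = _ := by
        rw [hw, mul_sub, sub_mul, mul_smul_comm, mul_one, smul_mul_assoc]
        simp only [star_mul, mul_assoc]
  rw [e, map_sub, map_smul, Complex.sub_re, smul_eq_mul, Complex.re_ofReal_mul,
    ← φ.norm_toPreGNS_sq, ← φ.norm_toPreGNS_sq] at h0
  refine le_of_sq_le_sq ?_ (mul_nonneg (apply_nonneg _ _) (norm_nonneg _))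
  rw [mul_pow]
  linarith

/-- A self-adjoint bounded element outside the cone is not strictly positive in some state. -/
theorem exists_starState_re_nonpos {c : selfAdjoint (boundedElements T)}
    (hc : ((c : boundedElements T) : T) ∉ sumsOfSquares T) :
    ∃ φ : StarState (boundedElements T), (φ.toLinearMap c).re ≤ 0 := by
  let E := selfAdjoint (boundedElements T)
  have hcoe : ∀ (r : ℝ) (y : E), ((r • y : E) : T) = (r : ℂ) • (y : T) := fun r y => rfl
  -- The cone generated by the positive elements and `-c`; a functional nonnegative on it is
  -- positive and at most `0` at `c`.
  let s : PointedCone ℝ E :=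
    { carrier := {y | ∃ t : ℝ, 0 ≤ t ∧ ((y + t • c : E) : T) ∈ sumsOfSquares T}
      add_mem' := by
        rintro y z ⟨t, ht, hy⟩ ⟨u, hu, hz⟩
        refine ⟨t + u, add_nonneg ht hu, ?_⟩
        convert add_mem hy hz using 1
        rw [show y + z + (t + u) • c = (y + t • c) + (z + u • c) by module]
        rfl
      zero_mem' := ⟨0, le_rfl, by simp⟩
      smul_mem' := by
        rintro ⟨r, hr⟩ y ⟨t, ht, hy⟩
        refine ⟨r * t, mul_nonneg hr ht, ?_⟩
        have := smul_mem_K hy hr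
        rw [← hcoe, smul_add, smul_smul] at this
        exact this }
  have h1K : (1 : T) ∈ sumsOfSquares T := by simpa using star_mul_self_mem_K (1 : T)
  have h1 : (1 : E) ≠ 0 := by
    intro h
    apply hc
    have h2 : (1 : T) = 0 := congrArg (fun y : E => (y : T)) h
    rw [← mul_one ((c : boundedElements T) : T), h2, mul_zero]
    exact zero_mem _
  let f : E →ₗ.[ℝ] ℝ := LinearPMap.mkSpanSingleton (σ := RingHom.id ℝ) (1 : E) (1 : ℝ) h1
  -- If `r 1 + t c ≥ 0` with `r < 0`, then `t c ≥ 0`: for `t > 0` this puts `c` in the cone, and for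
  -- `t = 0` properness of the cone gives `1 = 0`.
  have hf : ∀ y : f.domain, (y : E) ∈ s → 0 ≤ f y := by
    rintro ⟨y, hy⟩ ⟨t, ht, hK⟩
    obtain ⟨r, rfl⟩ := Submodule.mem_span_singleton.1 hy
    rw [LinearPMap.mkSpanSingleton'_apply]
    simp only [RingHom.id_apply, smul_eq_mul, mul_one]
    by_contra! hr
    have hK' : (r : ℂ) • (1 : T) + ((t • c : E) : T) ∈ sumsOfSquares T := hK
    have h2 := smul_mem_K h1K (neg_nonneg.2 hr.le)
    rcases ht.eq_or_lt with rfl | ht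
    · simp only [zero_smul, ZeroMemClass.coe_zero, add_zero] at hK'
      have h3 := eq_zero_of_mem_K_of_neg_mem_K hK' (by simpa using h2)
      have h4 : (1 : T) = 0 :=
        (smul_eq_zero_iff_right (Complex.ofReal_ne_zero.2 hr.ne)).1 h3
      exact h1 (Subtype.ext (Subtype.ext h4))
    · refine hc (mem_K_of_smul_mem_K ht (?_ : ((t • c : E) : T) ∈ sumsOfSquares T))
      have h3 := add_mem hK' h2
      rwa [Complex.ofReal_neg, neg_smul, add_neg_cancel_comm] at h3
  -- The cofinality required by the Riesz extension theorem holds because `1` is an order unit of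
  -- `M_h`.
  have hdense : ∀ y : E, ∃ x : f.domain, (x : E) + y ∈ s := fun y => by
    have hb := IsBoundedElement.sABound_cstarNorm y.1.2 (isSelfAdjoint_coe y)
    refine ⟨⟨cstarNorm (y : T) • 1,
      Submodule.smul_mem _ _ (Submodule.mem_span_singleton_self _)⟩, 0, le_rfl, ?_⟩
    rw [zero_smul, add_zero]
    exact hb.2.2.1
  obtain ⟨g, hg1, hgs⟩ := riesz_extension s f hf hdense
  have hg1' : g 1 = 1 := by
    have := hg1 ⟨1, Submodule.mem_span_singleton_self _⟩
    rwa [LinearPMap.mkSpanSingleton_apply] at this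
  obtain ⟨φ, hφ⟩ := exists_starState_of_selfAdjoint g hg1' fun x =>
    hgs _ ⟨0, le_rfl, by
      rw [zero_smul, add_zero]
      exact star_mul_self_mem_K (x : T)⟩
  refine ⟨φ, ?_⟩
  have h2 : 0 ≤ g (-c) := hgs _ ⟨1, zero_le_one, by simp⟩
  rw [map_neg] at h2
  rw [hφ, Complex.ofReal_re]
  linarith

theorem exists_starState_sq_le {x : boundedElements T} {r : ℝ} (hr : 0 ≤ r)
    (hx : r < boundedElementsNorm T x) :
    ∃ φ : StarState (boundedElements T), r ^ 2 ≤ (φ.toLinearMap (star x * x)).re := by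
  have hc := mt (IsBoundedElement.cstarNorm_le_iff x.2 hr).2 (not_le.2 hx)
  -- Here `c = r² 1 - x* x`, which is outside the cone precisely because `r < q(x)`.
  obtain ⟨φ, hφ⟩ := exists_starState_re_nonpos
    (c := ⟨((r ^ 2 : ℝ) : ℂ) • 1 - star x * x, by
      refine IsSelfAdjoint.sub ?_ (IsSelfAdjoint.star_mul_self x)
      rw [IsSelfAdjoint, star_smul, star_one, Complex.star_def, Complex.conj_ofReal]⟩) hc
  refine ⟨φ, ?_⟩
  have h1 : φ.toLinearMap 1 = 1 := φ.one'
  rw [map_sub, map_smul, h1, smul_eq_mul, mul_one, Complex.sub_re, Complex.ofReal_re] at hφ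
  linarith

variable (T) in
/-- The universal GNS representation of the bounded elements is isometric. -/
theorem exists_isUniversalGNSRep_norm_eq :
    ∃ π : boundedElements T →⋆ₐ[ℂ]
        (UniversalGNS (boundedElements T) →L[ℂ] UniversalGNS (boundedElements T)),
      IsUniversalGNSRep π ∧ ∀ x, boundedElementsNorm T x = ‖π x‖ := by
  obtain ⟨π, hπ, hle⟩ := exists_isUniversalGNSRep (boundedElementsNorm T)
    (fun x => apply_nonneg _ x) StarState.norm_toPreGNS_mul_le
  refine ⟨π, hπ, fun x => le_antisymm (le_of_forall_lt_imp_le_of_dense fun r hr => ?_) (hle x)⟩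
  rcases le_total r 0 with h0 | h0
  · exact h0.trans (norm_nonneg _)
  · obtain ⟨φ, hφ⟩ := exists_starState_sq_le h0 hr
    exact le_of_sq_le_sq (hφ.trans (hπ.re_apply_le φ x)) (norm_nonneg _)

end BoundedStates

theorem theorem1 (T : Type*) [Ring T] [StarRing T] [Algebra ℂ T] [StarModule ℂ T]
    [ROStarAlgebra T] :
    -- the order-unit norm makes `M_h` a real Banach space in which the positive cone is closed
    (∃ p : AddGroupNorm (selfAdjoint (boundedElements T)),
      (∀ x, p x = orderUnitNorm (x : T)) ∧
      (∀ (r : ℝ) (x : selfAdjoint (boundedElements T)), p (r • x) = |r| * p x) ∧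
      letI := p.toNormedAddCommGroup
      CompleteSpace (selfAdjoint (boundedElements T)) ∧
      IsClosed {x : selfAdjoint (boundedElements T) | KLE 0 (x : T)}) ∧
    -- it extends to a complete C*-norm on `M`, the operator norm in the direct sum of the GNS
    -- representations of all states, which is a faithful representation
    (∃ q : AlgebraNorm ℂ (boundedElements T),
      (letI := q.toNormedRing
       CStarRing (boundedElements T) ∧ CompleteSpace (boundedElements T)) ∧
      (∀ x : selfAdjoint (boundedElements T), q x = orderUnitNorm (x : T)) ∧
      ∃ π : boundedElements T →⋆ₐ[ℂ]
          (UniversalGNS (boundedElements T) →L[ℂ] UniversalGNS (boundedElements T)),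
        IsUniversalGNSRep π ∧ Function.Injective π ∧ ∀ x, q x = ‖π x‖) := by
  obtain ⟨π, hπ, hπq⟩ := exists_isUniversalGNSRep_norm_eq T
  refine ⟨⟨selfAdjointNorm T, boundedElementsNorm_selfAdjoint, selfAdjointNorm_smul,
    completeSpace_selfAdjoint, isClosed_selfAdjoint_nonneg⟩,
    boundedElementsNorm T, ⟨cStarRing_boundedElements, completeSpace_boundedElements⟩,
    boundedElementsNorm_selfAdjoint, π, hπ, ?_, hπq⟩
  refine (injective_iff_map_eq_zero π).2 fun x hx => ?_
  exact eq_zero_of_map_eq_zero (boundedElementsNorm T) (by rw [hπq, hx, norm_zero])
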